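/- **Setting.** Let $V$ be a variety of algebras with a finite equational basis $\Phi$, and let $\alpha\approx\beta$ be an equation in the language of $V$ in a single variable. Expand the language of $V$ with a new unary connective $\Box$ and a new binary connective $\to$, and let $Fm$ be the set of formulas of the expanded language over a countably infinite set of variables. Let $\mathcal L(\alpha,\beta)$ be the logic (structural closure operator on $Fm$) determined by the Hilbert calculus with the following rules, where $f$ ranges over all $n$-ary connectives of the expanded language (for every $n\ge 0$), $\epsilon\approx\delta$ over $\Phi$, and $\varphi$ over the formulas $\varphi_1,\dots,\varphi_6$ below: - (R) $\emptyset\vdash x\to x$; - (MP) $x,\ x\to y\vdash y$; - (Rep) $\{x_i\to y_i,\ y_i\to x_i: 1\le i\le n\}\vdash f(x_1,\dots,x_n)\to f(y_1,\dots,y_n)$; - (A3) $x\vdash \Box x\to x$, $\ x\vdash x\to\Box x$, $\ \Box x\to x,\ x\to\Box x\vdash x$; - (V) $\emptyset\vdash\epsilon\to\delta$, $\ \emptyset\vdash\delta\to\epsilon$; - (W) $\alpha(\varphi)\to\beta(\varphi)\vdash\varphi$, with $\varphi_1 = x\to(y\to x)$; $\varphi_2=(x\to(y\to z))\to((x\to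 y)\to(x\to z))$; $\varphi_3=(x_1\to y_1)\to((y_1\to x_1)\to(\cdots\to((x_n\to y_n)\to((y_n\to x_n)\to(f(x_1,\dots,x_n)\to f(y_1,\dots,y_n))))\cdots))$ (one formula for each connective $f$); $\varphi_4=x\to(x\to\Box x)$; $\varphi_5=x\to(\Box x\to x)$; $\varphi_6=(\Box x\to x)\to((x\to\Box x)\to x)$. **Notions.** For an algebra $\mathbf A$ of the type of a logic $\mathcal L$, a deductive filter is a set $F\subseteq A$ such that, whenever $\Gamma\vdash_{\mathcal L}\varphi$ and $h\colon \mathbf{Fm}\to\mathbf A$ is a homomorphism with $h[\Gamma]\subseteq F$, also $h(\varphi)\in F$; $\mathrm{Fi}(X)$ is the least deductive filter containing $X$. The Leibniz congruence $\Omega F$ of $F\subseteq A$ is the largest congruence of $\mathbf A$ for which $F$ is a union of classes; the Suszko congruence of $F$ is $\widetilde\Omega F=\bigcap\{\Omega G: G\supseteq F \text{ a deductive filter}\}$; and $\mathrm{Alg}\,\mathcal L$ is the class of algebras that have a deductive filter $F$ with $\widetilde\Omega F=\mathrm{Id}$. The logic $\mathcal L$ is - *selfextensional* if the relation "$\varphi\vdash_{\mathcal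 L}\psi$ and $\psi\vdash_{\mathcal L}\varphi$" is a congruence of $\mathbf{Fm}$; - *fully Fregean* if for all $\mathbf A\in\mathrm{Alg}\,\mathcal L$, all deductive filters $F$ of $\mathbf A$ and all $a,b\in A$, $\mathrm{Fi}(F\cup\{a\})=\mathrm{Fi}(F\cup\{b\})$ implies $\langle a,b\rangle\in\widetilde\Omega F$; - *finitely algebraizable* if (1) there is a finite set $\Delta(x,y)$ of formulas such that for every algebra $\mathbf A$, every deductive filter $F$ and all $a,b\in A$, $\langle a,b\rangle\in\Omega F$ iff $\Delta^{\mathbf A}(a,b)\subseteq F$; and (2) there is a set $\tau(x)$ of equations such that $F=\{a\in A:\mathbf A\models\tau(a)\}$ for every algebra $\mathbf A$ and every deductive filter $F$ with $\Omega F=\mathrm{Id}$. **Theorem.** The logic $\mathcal L(\alpha,\beta)$ is finitely algebraizable, and the following conditions are equivalent: 1. $\mathcal L(\alpha,\beta)$ is fully Fregean; 2. $\mathcal L(\alpha,\beta)$ is selfextensional; 3. $V\models\alpha\approx\beta$. -/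

import Mathlib

open scoped FirstOrder

universe u v

namespace AAL

/-! ### Terms, algebras, congruences

An algebraic type is a first-order language without relation symbols, an algebra is a structure
for it, and the formulas over a set of variables are the terms over it. -/

/-- The formulas over the fixed countably infinite set of variables. -/
abbrev Fm (L : FirstOrder.Language.{u, v}) : Type u := L.Term ℕ

/-- The absolutely free algebra over a set `X` of variables (there are no relation symbols in the
cases of interest, so that the interpretation of relations plays no role). -/
instance termStructure (L : FirstOrder.Language.{u, v}) (X : Type) : L.Structure (L.Term X) where
  funMap f ts := FirstOrder.Language.Term.func f ts
  RelMap _ _ := False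

section Algebra

variable {L : FirstOrder.Language.{u, v}}

/-- An equation in the variables `X`. -/
abbrev Equation (L : FirstOrder.Language.{u, v}) (X : Type) : Type u := L.Term X × L.Term X

/-- The algebra `A` satisfies the equation `e`. -/
def Satisfies (A : Type u) [L.Structure A] {X : Type} (e : Equation L X) : Prop :=
  ∀ a : X → A, e.1.realize a = e.2.realize a

/-- A binary relation on `A` is a congruence of the algebra `A`. -/
structure IsCongruence (L : FirstOrder.Language.{u, v}) {A : Type u} [L.Structure A]
    (r : A → A → Prop) : Prop where
  equivalence : Equivalence r
  compat : ∀ {n : ℕ} (f : L.Functions n) (a b : Fin n → A), (∀ i, r (a i) (b i)) →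
    r (FirstOrder.Language.Structure.funMap f a) (FirstOrder.Language.Structure.funMap f b)

/-- A relation is compatible with the set `F`. -/
def Compatible {A : Type u} (r : A → A → Prop) (F : Set A) : Prop :=
  ∀ a b, r a b → a ∈ F → b ∈ F

/-- The Leibniz congruence of `F`: the largest congruence compatible with `F`, given as the union
of all of them (see `isCongruence_leibniz`, `compatible_leibniz` and `le_leibniz`). -/
def leibniz (L : FirstOrder.Language.{u, v}) {A : Type u} [L.Structure A] (F : Set A) (a b : A) : Prop :=
  ∃ r : A → A → Prop, IsCongruence L r ∧ Compatible r F ∧ r a b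

theorem le_leibniz {A : Type u} [L.Structure A] {F : Set A} {r : A → A → Prop}
    (hr : IsCongruence L r) (hF : Compatible r F) {a b : A} (h : r a b) : leibniz L F a b :=
  ⟨r, hr, hF, h⟩

theorem compatible_leibniz {A : Type u} [L.Structure A] (F : Set A) :
    Compatible (leibniz L F) F := fun _ _ ⟨_, _, hF, h⟩ ha => hF _ _ h ha

/-- Indiscernibility with respect to `F` by unary polynomial functions. -/
def indisc (L : FirstOrder.Language.{u, v}) {A : Type u} [L.Structure A] (F : Set A) (a b : A) : Prop :=
  ∀ t : L.Term (Option A), t.realize (fun o => o.getD a) ∈ F ↔ t.realize (fun o => o.getD b) ∈ F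

theorem isCongruence_indisc {A : Type u} [L.Structure A] (F : Set A) :
    IsCongruence L (indisc L F) where
  equivalence := ⟨fun _ _ => Iff.rfl, fun h t => (h t).symm, fun h h' t => (h t).trans (h' t)⟩
  compat := by
    classical
    intro n f a b hab t
    have key : ∀ S : Finset (Fin n),
        t.realize (fun o => o.getD (FirstOrder.Language.Structure.funMap f a)) ∈ F ↔
        t.realize (fun o => o.getD
          (FirstOrder.Language.Structure.funMap f (fun i => if i ∈ S then b i else a i))) ∈ F := by
      intro S
      induction S using Finset.induction_on with
      | empty => simp
      | insert i S hi ih =>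
        rw [ih]
        let s : Option A → L.Term (Option A) := fun o => o.elim
          (FirstOrder.Language.Term.func f fun j => if j = i then FirstOrder.Language.Term.var none else
            FirstOrder.Language.Term.var (some (if j ∈ S then b j else a j)))
          (fun c => FirstOrder.Language.Term.var (some c))
        have hs : ∀ c : A, (t.subst s).realize (fun o => o.getD c) =
            t.realize (fun o => o.getD (FirstOrder.Language.Structure.funMap f
              (fun j => if j = i then c else if j ∈ S then b j else a j))) := by
          intro c
          rw [FirstOrder.Language.Term.realize_subst]
          congr 1
          funext o
          cases o with
          | some d => simp [s]
          | none =>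
            simp only [s, Option.elim, FirstOrder.Language.Term.realize_func, Option.getD_none]
            congr 1
            funext j
            by_cases hj : j = i <;> simp [hj]
        have := hab i (t.subst s)
        rw [hs, hs] at this
        have ha : (fun j => if j = i then a i else if j ∈ S then b j else a j) =
            fun j => if j ∈ S then b j else a j := by
          funext j
          by_cases hj : j = i
          · subst hj; simp [hi]
          · simp [hj]
        have hb : (fun j => if j = i then b i else if j ∈ S then b j else a j) =
            fun j => if j ∈ insert i S then b j else a j := by
          funext j
          by_cases hj : j = i
          · subst hj; simp
          · simp [hj]
        rw [ha, hb] at this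
        exact this
    simpa using key Finset.univ

theorem realize_rel {A : Type u} [L.Structure A] {r : A → A → Prop}
    (hr : IsCongruence L r) {X : Type*} (t : L.Term X) (x y : X → A) (h : ∀ i, r (x i) (y i)) :
    r (t.realize x) (t.realize y) := by
  induction t with
  | var i => exact h i
  | func f ts ih => exact hr.compat f _ _ ih

theorem isCongruence_leibniz {A : Type u} [L.Structure A] (F : Set A) :
    IsCongruence L (leibniz L F) := by
  have : leibniz L F = indisc L F := by
    funext a b
    refine propext ⟨?_, fun h => ⟨_, isCongruence_indisc F, ?_, h⟩⟩
    · rintro ⟨r, hr, hF, h⟩ t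
      have h1 : r (t.realize (fun o => o.getD a)) (t.realize (fun o => o.getD b)) := by
        refine realize_rel hr t _ _ ?_
        rintro (_ | c)
        · exact h
        · exact hr.equivalence.refl c
      exact ⟨hF _ _ h1, hF _ _ (hr.equivalence.symm h1)⟩
    · intro c d hcd hc
      exact (hcd (FirstOrder.Language.Term.var none)).1 hc
  rw [this]
  exact isCongruence_indisc F

end Algebra

/-! ### Classes of algebras and equational bases -/

/-- A class of algebras of type `L`. -/
abbrev AlgebraClass (L : FirstOrder.Language.{u, v}) : Type (max (u + 1) v) :=
  ∀ (A : Type u) [L.Structure A], Prop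

/-- `V ⊨ e`: every algebra in `V` satisfies the equation `e`. -/
def AlgebraClass.Models {L : FirstOrder.Language.{u, v}} (V : AlgebraClass L) {X : Type}
    (e : Equation L X) : Prop :=
  ∀ (A : Type u) [L.Structure A] [Nonempty A], V A → Satisfies A e

/-- `V` is the variety axiomatized by the set `Φ` of equations. -/
def IsEquationalBasis {L : FirstOrder.Language.{u, v}} (Φ : Set (Equation L ℕ)) (V : AlgebraClass L) : Prop :=
  ∀ (A : Type u) [L.Structure A] [Nonempty A], V A ↔ ∀ e ∈ Φ, Satisfies A e

/-! ### Logics and Hilbert calculi -/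

/-- A logic: a structural closure operator on the set of formulas. Substitutions, i.e. the
endomorphisms of the formula algebra, are given by their values on the variables. -/
structure Logic (L : FirstOrder.Language.{u, v}) where
  C : ClosureOperator (Set (Fm L))
  structural : ∀ (σ : ℕ → Fm L) (Γ : Set (Fm L)),
    (fun φ : Fm L => φ.subst σ) '' C Γ ⊆ C ((fun φ : Fm L => φ.subst σ) '' Γ)

/-- A rule: finitely many premises and a conclusion. -/
structure Rule (L : FirstOrder.Language.{u, v}) where
  premises : Set (Fm L)
  finite : premises.Finite
  conclusion : Fm L

/-- A Hilbert calculus is a set of rules. -/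
abbrev HilbertCalculus (L : FirstOrder.Language.{u, v}) : Type u := Set (Rule L)

/-- Derivability from `Γ` in the calculus `H`: hypotheses, and substitution instances of rules. -/
inductive Derives {L : FirstOrder.Language.{u, v}} (H : HilbertCalculus L) (Γ : Set (Fm L)) : Fm L → Prop
  | hyp {φ : Fm L} : φ ∈ Γ → Derives H Γ φ
  | rule (ρ : Rule L) (σ : ℕ → Fm L) : ρ ∈ H →
      (∀ ψ ∈ ρ.premises, Derives H Γ (ψ.subst σ)) → Derives H Γ (ρ.conclusion.subst σ)

theorem subst_subst {L : FirstOrder.Language.{u, v}} (φ : Fm L) (σ τ : ℕ → Fm L) :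
    (φ.subst σ).subst τ = φ.subst (fun i => (σ i).subst τ) := by
  induction φ with
  | var i => rfl
  | func f ts ih => simp only [FirstOrder.Language.Term.subst, ih]

theorem Derives.cut {L : FirstOrder.Language.{u, v}} {H : HilbertCalculus L} {Γ Δ : Set (Fm L)}
    (h : ∀ φ ∈ Γ, Derives H Δ φ) {φ : Fm L} (hφ : Derives H Γ φ) : Derives H Δ φ := by
  induction hφ with
  | hyp hm => exact h _ hm
  | rule ρ σ hρ _ ih => exact Derives.rule ρ σ hρ ih

theorem Derives.subst {L : FirstOrder.Language.{u, v}} {H : HilbertCalculus L} {Γ : Set (Fm L)}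
    (τ : ℕ → Fm L) {φ : Fm L} (hφ : Derives H Γ φ) :
    Derives H ((fun φ : Fm L => φ.subst τ) '' Γ) (φ.subst τ) := by
  induction hφ with
  | hyp hm => exact Derives.hyp ⟨_, hm, rfl⟩
  | rule ρ σ hρ _ ih =>
    rw [subst_subst]
    refine Derives.rule ρ _ hρ fun ψ hψ => ?_
    rw [← subst_subst]
    exact ih ψ hψ

/-- The logic determined by a Hilbert calculus. -/
def HilbertCalculus.logic {L : FirstOrder.Language.{u, v}} (H : HilbertCalculus L) : Logic L where
  C := ClosureOperator.mk' (fun Γ => {φ | Derives H Γ φ})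
    (fun _ _ h _ hφ => Derives.cut (fun _ hψ => Derives.hyp (h hψ)) hφ)
    (fun _ _ hφ => Derives.hyp hφ)
    (fun _ _ hφ => Derives.cut (fun _ hψ => hψ) hφ)
  structural := by
    rintro σ Γ _ ⟨φ, hφ, rfl⟩
    exact Derives.subst σ hφ

section Hierarchies

variable {L : FirstOrder.Language.{u, v}} (𝓛 : Logic L)

/-- `Γ ⊢ φ` in the logic. -/
def Logic.Entails (Γ : Set (Fm L)) (φ : Fm L) : Prop := φ ∈ 𝓛.C Γ

/-- Interderivability of two formulas. -/
def Logic.InterDerivable (φ ψ : Fm L) : Prop := 𝓛.Entails {φ} ψ ∧ 𝓛.Entails {ψ} φ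

/-- `F` is a deductive filter of the logic over `A`. The homomorphisms from the formula algebra to
`A` are the evaluations of formulas under assignments of elements of `A` to the variables. -/
def Logic.IsFilter {A : Type u} [L.Structure A] (F : Set A) : Prop :=
  ∀ (Γ : Set (Fm L)) (φ : Fm L), 𝓛.Entails Γ φ → ∀ h : ℕ → A,
    (∀ γ ∈ Γ, γ.realize h ∈ F) → φ.realize h ∈ F

/-- The deductive filter generated by `X`. -/
def Logic.Fi {A : Type u} [L.Structure A] (X : Set A) : Set A :=
  ⋂₀ {F | 𝓛.IsFilter F ∧ X ⊆ F}

/-- The Suszko congruence of `F`: the intersection of the Leibniz congruences of the deductive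
filters that contain `F`. -/
def Logic.suszko {A : Type u} [L.Structure A] (F : Set A) (a b : A) : Prop :=
  ∀ G : Set A, 𝓛.IsFilter G → F ⊆ G → leibniz L G a b

/-- `A` belongs to the class `Alg 𝓛`. -/
def Logic.InAlg (A : Type u) [L.Structure A] : Prop :=
  ∃ F : Set A, 𝓛.IsFilter F ∧ ∀ a b, 𝓛.suszko F a b ↔ a = b

/-- `⟨A, F⟩` is a reduced model of the logic. -/
def Logic.IsReducedModel {A : Type u} [L.Structure A] (F : Set A) : Prop :=
  𝓛.IsFilter F ∧ ∀ a b, leibniz L F a b ↔ a = b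

/-- The logic is selfextensional: interderivability is a congruence of the formula algebra. -/
def Logic.Selfextensional : Prop := IsCongruence L 𝓛.InterDerivable

/-- The logic is fully Fregean. -/
def Logic.FullyFregean : Prop :=
  ∀ (A : Type u) [L.Structure A] [Nonempty A], 𝓛.InAlg A → ∀ F : Set A, 𝓛.IsFilter F →
    ∀ a b : A, 𝓛.Fi (F ∪ {a}) = 𝓛.Fi (F ∪ {b}) → 𝓛.suszko F a b

/-- `Δ(x, y)` is a set of congruence formulas (without parameters): it defines the Leibniz
congruence of every deductive filter. -/
def Logic.IsCongruenceFormulas (Δ : Set (L.Term (Fin 2))) : Prop :=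
  ∀ (A : Type u) [L.Structure A] [Nonempty A] (F : Set A), 𝓛.IsFilter F → ∀ a b : A,
    leibniz L F a b ↔ ∀ δ ∈ Δ, δ.realize ![a, b] ∈ F

/-- Truth is defined by a set of equations in one variable in the reduced models. -/
def Logic.TruthEquational : Prop :=
  ∃ τ : Set (Equation L Unit), ∀ (A : Type u) [L.Structure A] [Nonempty A] (F : Set A),
    𝓛.IsReducedModel F →
      F = {a | ∀ e ∈ τ, e.1.realize (fun _ => a) = e.2.realize (fun _ => a)}

/-- The logic is finitely algebraizable: it is truth-equational and has a finite set of congruence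
formulas without parameters. -/
def Logic.FinitelyAlgebraizable : Prop :=
  (∃ Δ : Set (L.Term (Fin 2)), Δ.Finite ∧ 𝓛.IsCongruenceFormulas Δ) ∧ 𝓛.TruthEquational

end Hierarchies

/-! ### The logic attached to an equational basis and an equation in one variable -/

/-- The two new connectives. -/
inductive NewConnective : ℕ → Type
  | box : NewConnective 1
  | imp : NewConnective 2

/-- The algebraic type consisting of the two new connectives. -/
def newLang : FirstOrder.Language.{0, 0} := ⟨NewConnective, fun _ => Empty⟩

/-- The expansion of `L` with the two new connectives. -/
abbrev expand (L : FirstOrder.Language.{u, v}) : FirstOrder.Language.{u, v} := L.sum newLang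

section Calculus

variable {L : FirstOrder.Language.{u, v}}

/-- The formula `□ φ`. -/
def box (φ : Fm (expand L)) : Fm (expand L) :=
  FirstOrder.Language.Term.func (l := 1) (Sum.inr NewConnective.box) ![φ]

/-- The formula `φ → ψ`. -/
def imp (φ ψ : Fm (expand L)) : Fm (expand L) :=
  FirstOrder.Language.Term.func (l := 2) (Sum.inr NewConnective.imp) ![φ, ψ]

/-- A term of the smaller type as a term of the expanded type. -/
def lift {X : Type} (t : L.Term X) : (expand L).Term X :=
  (FirstOrder.Language.LHom.sumInl : L →ᴸ expand L).onTerm t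

/-- The formula `α(φ)` for a term `α` in one variable. -/
def plug (α : L.Term Unit) (φ : Fm (expand L)) : Fm (expand L) := (lift α).subst fun _ => φ

/-- The `i`-th variable as a formula. -/
def var (L : FirstOrder.Language.{u, v}) (i : ℕ) : Fm (expand L) := FirstOrder.Language.Term.var i

/-- The variables `x₁, x₂, …`, which are pairwise distinct and distinct from `y₁, y₂, …`. -/
def xs (L : FirstOrder.Language.{u, v}) {n : ℕ} (i : Fin n) : Fm (expand L) := var L (2 * i)

/-- The variables `y₁, y₂, …`. -/
def ys (L : FirstOrder.Language.{u, v}) {n : ℕ} (i : Fin n) : Fm (expand L) := var L (2 * i + 1)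

/-- `f(x₁, …, xₙ) → f(y₁, …, yₙ)`. -/
def repConclusion {n : ℕ} (f : (expand L).Functions n) : Fm (expand L) :=
  imp (FirstOrder.Language.Term.func f (xs L)) (FirstOrder.Language.Term.func f (ys L))

/-- `(x₁ → y₁) → ((y₁ → x₁) → (… → ((xₙ → yₙ) → ((yₙ → xₙ) → (f(x₁, …, xₙ) → f(y₁, …, yₙ))))…))`. -/
def repFormula {n : ℕ} (f : (expand L).Functions n) : Fm (expand L) :=
  (List.finRange n).foldr
    (fun i χ => imp (imp (xs L i) (ys L i)) (imp (imp (ys L i) (xs L i)) χ)) (repConclusion f)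

/-- The list of formulas `φ₁, …, φ₆`, the third of which is a family indexed by the connectives. -/
inductive IsPhi : Fm (expand L) → Prop
  | phi1 : IsPhi (imp (var L 0) (imp (var L 1) (var L 0)))
  | phi2 : IsPhi (imp (imp (var L 0) (imp (var L 1) (var L 2)))
      (imp (imp (var L 0) (var L 1)) (imp (var L 0) (var L 2))))
  | phi3 {n : ℕ} (f : (expand L).Functions n) : IsPhi (repFormula f)
  | phi4 : IsPhi (imp (var L 0) (imp (var L 0) (box (var L 0))))
  | phi5 : IsPhi (imp (var L 0) (imp (box (var L 0)) (var L 0)))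
  | phi6 : IsPhi (imp (imp (box (var L 0)) (var L 0))
      (imp (imp (var L 0) (box (var L 0))) (var L 0)))

/-- The rules of the Hilbert calculus given by `Φ` and `α ≈ β`. -/
inductive IsRule (Φ : Set (Equation L ℕ)) (α β : L.Term Unit) : Rule (expand L) → Prop
  | R : IsRule Φ α β ⟨∅, Set.toFinite _, imp (var L 0) (var L 0)⟩
  | MP : IsRule Φ α β ⟨{var L 0, imp (var L 0) (var L 1)}, Set.toFinite _, var L 1⟩
  | Rep {n : ℕ} (f : (expand L).Functions n) : IsRule Φ α β
      ⟨Set.range (fun i : Fin n => imp (xs L i) (ys L i)) ∪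
        Set.range (fun i : Fin n => imp (ys L i) (xs L i)), Set.toFinite _, repConclusion f⟩
  | A3₁ : IsRule Φ α β ⟨{var L 0}, Set.toFinite _, imp (box (var L 0)) (var L 0)⟩
  | A3₂ : IsRule Φ α β ⟨{var L 0}, Set.toFinite _, imp (var L 0) (box (var L 0))⟩
  | A3₃ : IsRule Φ α β ⟨{imp (box (var L 0)) (var L 0), imp (var L 0) (box (var L 0))},
      Set.toFinite _, var L 0⟩
  | V₁ {e : Equation L ℕ} (he : e ∈ Φ) :
      IsRule Φ α β ⟨∅, Set.toFinite _, imp (lift e.1) (lift e.2)⟩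
  | V₂ {e : Equation L ℕ} (he : e ∈ Φ) :
      IsRule Φ α β ⟨∅, Set.toFinite _, imp (lift e.2) (lift e.1)⟩
  | W {φ : Fm (expand L)} (hφ : IsPhi φ) :
      IsRule Φ α β ⟨{imp (plug α φ) (plug β φ)}, Set.toFinite _, φ⟩

/-- The Hilbert calculus given by the basis `Φ` and the equation `α ≈ β`. -/
def calculus (Φ : Set (Equation L ℕ)) (α β : L.Term Unit) : HilbertCalculus (expand L) :=
  {ρ | IsRule Φ α β ρ}

/-- The logic `𝓛(α, β)`, relative to the basis `Φ`. -/
def logicOf (Φ : Set (Equation L ℕ)) (α β : L.Term Unit) : Logic (expand L) :=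
  (calculus Φ α β).logic

end Calculus

end AAL

/-!
Write `a ⇒ b` for the interpretation of the new implication and `□ a` for that of the box.

*Algebraizability.* In a deductive filter `F`, the relation `a ⇒ b ∈ F` and `b ⇒ a ∈ F` is a
congruence by (R), (Rep) and (MP), it is compatible with `F` by (MP), and it contains `Ω F` by (R).
Hence `{x → y, y → x}` defines `Ω F` (`IsModel.leibniz_iff`), and (A3) then says
that in reduced models truth is defined by `□ x ≈ x`.

*Fully Fregean implies selfextensional.* The quotient of the formula algebra by the Leibniz
congruence of the set of theorems is in `Alg`, and interderivable formulas generate the same filter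
there, so they are identified. Thus interderivability is that Leibniz congruence
(`selfextensional_of_fullyFregean`).

*Selfextensional implies `V ⊨ α ≈ β`.* If `α` and `β` differ at some point `o` of an algebra in `V`,
which may be taken to have at least three elements after replacing it by its square, interpret
`a ⇒ b` as `o` for `a ≠ b`, and let `a ⇒ a` take at least two values different from `o`; designate
everything but `o`. The premise of (W) fails whenever the conclusion does, because the only
undesignated value is `o`. So this is a model, while `(x → x) → (y → y)` is not valid in it although
selfextensionality would make it a theorem, both sides being theorems
(`isModel_counterFilter`).

*`V ⊨ α ≈ β` implies fully Fregean.* Quotients by Leibniz congruences of filters have their reduct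
in `V`, so the premises of (W) are theorems and so are `φ₁, …, φ₆`. These formulas are precisely
what is needed for `{c | a ⇒ c ∈ F}` to be a deductive filter (`isModel_residual`), which gives the
deduction theorem `b ∈ Fi (F ∪ {a}) → a ⇒ b ∈ F` in every algebra.
-/

namespace AAL

open FirstOrder.Language

/-! ### Deductive filters as models of the calculus -/

/-- The assignment sending `xᵢ` to `x i` and `yᵢ` to `y i`. The argument `d` is the value of the
remaining variables. -/
def interleave {A : Type u} {n : ℕ} (d : A) (x y : Fin n → A) (k : ℕ) : A :=
  if hk : k / 2 < n then if k % 2 = 0 then x ⟨k / 2, hk⟩ else y ⟨k / 2, hk⟩ else d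

theorem interleave_even {A : Type u} {n : ℕ} (d : A) (x y : Fin n → A) (i : Fin n) :
    interleave d x y (2 * i) = x i := by
  simp [interleave]

theorem interleave_odd {A : Type u} {n : ℕ} (d : A) (x y : Fin n → A) (i : Fin n) :
    interleave d x y (2 * i + 1) = y i := by
  have h : (2 * (i : ℕ) + 1) / 2 = i := by omega
  have h' : (2 * (i : ℕ) + 1) % 2 = 1 := by omega
  simp [interleave, h, h']

section Model

variable {L : FirstOrder.Language.{u, v}} {A : Type u} [(expand L).Structure A]

/-- The interpretation of the new implication. -/
def himp (L : FirstOrder.Language.{u, v}) {A : Type u} [(expand L).Structure A] (a b : A) : A :=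
  Structure.funMap (L := expand L) (n := 2) (Sum.inr NewConnective.imp) ![a, b]

/-- The interpretation of the box. -/
def hbox (L : FirstOrder.Language.{u, v}) {A : Type u} [(expand L).Structure A] (a : A) : A :=
  Structure.funMap (L := expand L) (n := 1) (Sum.inr NewConnective.box) ![a]

@[simp] theorem realize_imp (φ ψ : Fm (expand L)) (h : ℕ → A) :
    (imp φ ψ).realize h = himp L (φ.realize h) (ψ.realize h) := by
  refine congrArg (Structure.funMap _) (funext fun i => ?_)
  fin_cases i <;> rfl

@[simp] theorem realize_box (φ : Fm (expand L)) (h : ℕ → A) :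
    (box φ).realize h = hbox L (φ.realize h) := by
  refine congrArg (Structure.funMap _) (funext fun i => ?_)
  fin_cases i
  rfl

@[simp] theorem realize_var (i : ℕ) (h : ℕ → A) : (var L i).realize h = h i := rfl

@[simp] theorem realize_plug (α : L.Term Unit) (φ : Fm (expand L)) (h : ℕ → A) :
    (plug α φ).realize h = (lift α).realize fun _ => φ.realize h := by
  simp [plug, Term.realize_subst]

theorem realize_repConclusion {n : ℕ} (f : (expand L).Functions n) (h : ℕ → A) :
    (repConclusion f).realize h =
      himp L (Structure.funMap f fun i : Fin n => h (2 * i))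
        (Structure.funMap f fun i : Fin n => h (2 * i + 1)) := by
  simp only [repConclusion, realize_imp, Term.realize_func]
  rfl

/-- The semantic form of the rules of the calculus: `F` is closed under all of them. -/
structure IsModel (Φ : Set (Equation L ℕ)) (α β : L.Term Unit) (F : Set A) : Prop where
  refl : ∀ a : A, himp L a a ∈ F
  mp : ∀ a b : A, a ∈ F → himp L a b ∈ F → b ∈ F
  rep : ∀ {n : ℕ} (f : (expand L).Functions n) (x y : Fin n → A), (∀ i, himp L (x i) (y i) ∈ F) →
    (∀ i, himp L (y i) (x i) ∈ F) → himp L (Structure.funMap f x) (Structure.funMap f y) ∈ F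
  box_imp : ∀ a : A, a ∈ F → himp L (hbox L a) a ∈ F
  imp_box : ∀ a : A, a ∈ F → himp L a (hbox L a) ∈ F
  of_box : ∀ a : A, himp L (hbox L a) a ∈ F → himp L a (hbox L a) ∈ F → a ∈ F
  basis : ∀ e ∈ Φ, ∀ h : ℕ → A, himp L ((lift e.1).realize h) ((lift e.2).realize h) ∈ F
  basis_symm : ∀ e ∈ Φ, ∀ h : ℕ → A, himp L ((lift e.2).realize h) ((lift e.1).realize h) ∈ F
  weak : ∀ φ : Fm (expand L), IsPhi φ → ∀ h : ℕ → A, himp L ((lift α).realize fun _ => φ.realize h)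
    ((lift β).realize fun _ => φ.realize h) ∈ F → φ.realize h ∈ F

variable {Φ : Set (Equation L ℕ)} {α β : L.Term Unit} {F : Set A}

theorem entails_of_isRule {ρ : Rule (expand L)} (hρ : IsRule Φ α β ρ) :
    (logicOf Φ α β).Entails ρ.premises ρ.conclusion := by
  have key : ∀ t : Fm (expand L), t.subst (fun i => Term.var i) = t := by
    intro t
    induction t with
    | var i => rfl
    | func f ts ih => simp only [Term.subst, ih]
  have : Derives (calculus Φ α β) ρ.premises (ρ.conclusion.subst fun i => Term.var i) := by
    refine Derives.rule ρ _ hρ fun ψ hψ => ?_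
    rw [key]
    exact Derives.hyp hψ
  rwa [key] at this

theorem IsModel.isFilter (hF : IsModel Φ α β F) : (logicOf Φ α β).IsFilter F := by
  intro Γ φ hφ h hΓ
  change Derives _ _ _ at hφ
  induction hφ with
  | hyp hm => exact hΓ _ hm
  | rule ρ σ hρ _ ih =>
    have ih' : ∀ ψ ∈ ρ.premises, ψ.realize (fun i => (σ i).realize h) ∈ F := by
      intro ψ hψ
      rw [← Term.realize_subst]
      exact ih ψ hψ
    rw [Term.realize_subst]
    generalize (fun i => (σ i).realize h) = g at ih'
    clear ih
    cases hρ with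
    | R => simpa using hF.refl _
    | MP => exact hF.mp (g 0) (g 1) (by simpa using ih' (var L 0) (by simp))
              (by simpa using ih' (imp (var L 0) (var L 1)) (by simp))
    | Rep f =>
      rw [realize_repConclusion]
      refine hF.rep f _ _ (fun i => ?_) (fun i => ?_)
      · simpa [xs, ys] using ih' (imp (xs L i) (ys L i)) (Or.inl ⟨i, rfl⟩)
      · simpa [xs, ys] using ih' (imp (ys L i) (xs L i)) (Or.inr ⟨i, rfl⟩)
    | A3₁ => simpa using hF.box_imp (g 0) (by simpa using ih' (var L 0) (by simp))
    | A3₂ => simpa using hF.imp_box (g 0) (by simpa using ih' (var L 0) (by simp))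
    | A3₃ =>
      exact hF.of_box (g 0) (by simpa using ih' (imp (box (var L 0)) (var L 0)) (by simp))
        (by simpa using ih' (imp (var L 0) (box (var L 0))) (by simp))
    | V₁ he => simpa using hF.basis _ he g
    | V₂ he => simpa using hF.basis_symm _ he g
    | W hφ => exact hF.weak _ hφ g (by simpa using ih' _ rfl)

theorem isModel_of_isFilter [Nonempty A] (hF : (logicOf Φ α β).IsFilter F) :
    IsModel Φ α β F := by
  have key : ∀ (ρ : Rule (expand L)), IsRule Φ α β ρ → ∀ h : ℕ → A,
      (∀ ψ ∈ ρ.premises, ψ.realize h ∈ F) → ρ.conclusion.realize h ∈ F :=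
    fun ρ hρ => hF _ _ (entails_of_isRule hρ)
  refine ⟨?_, ?_, ?_, ?_, ?_, ?_, ?_, ?_, ?_⟩
  · intro a
    simpa using key _ .R (fun _ => a) (by simp)
  · intro a b ha hab
    simpa using key _ .MP (fun i => if i = 0 then a else b) (by simp [ha, hab])
  · intro n f x y hxy hyx
    obtain ⟨d⟩ := ‹Nonempty A›
    have := key _ (.Rep f) (interleave d x y) (by
      rintro ψ (⟨i, rfl⟩ | ⟨i, rfl⟩)
      · simpa [xs, ys, interleave_even, interleave_odd] using hxy i
      · simpa [xs, ys, interleave_even, interleave_odd] using hyx i)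
    simpa only [realize_repConclusion, interleave_even, interleave_odd] using this
  · intro a ha
    simpa using key _ .A3₁ (fun _ => a) (by simpa using ha)
  · intro a ha
    simpa using key _ .A3₂ (fun _ => a) (by simpa using ha)
  · intro a h1 h2
    simpa using key _ .A3₃ (fun _ => a) (by simp [h1, h2])
  · intro e he h
    simpa using key _ (.V₁ he) h (by simp)
  · intro e he h
    simpa using key _ (.V₂ he) h (by simp)
  · intro φ hφ h hp
    simpa using key _ (.W hφ) h (by simpa using hp)

/-! ### Leibniz congruences and algebraizability -/

theorem IsModel.trans (hF : IsModel Φ α β F) {a b c : A} (hab : himp L a b ∈ F)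
    (hbc : himp L b c ∈ F) (hcb : himp L c b ∈ F) : himp L a c ∈ F := by
  refine hF.mp _ _ hab (hF.rep (n := 2) (Sum.inr NewConnective.imp) ![a, b] ![a, c] ?_ ?_)
  · intro i
    fin_cases i
    exacts [hF.refl a, hbc]
  · intro i
    fin_cases i
    exacts [hF.refl a, hcb]

/-- Transitivity in the other order: (Rep) is applied to the left-hand side of the implication. -/
theorem IsModel.trans' (hF : IsModel Φ α β F) {a b c : A} (hbc : himp L b c ∈ F)
    (hab : himp L a b ∈ F) (hba : himp L b a ∈ F) : himp L a c ∈ F := by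
  refine hF.mp _ _ hbc (hF.rep (n := 2) (Sum.inr NewConnective.imp) ![b, c] ![a, c] ?_ ?_)
  · intro i
    fin_cases i
    exacts [hba, hF.refl c]
  · intro i
    fin_cases i
    exacts [hab, hF.refl c]

/-- `{x → y, y → x}` defines the Leibniz congruence of a deductive filter. -/
theorem IsModel.leibniz_iff (hF : IsModel Φ α β F) {a b : A} :
    leibniz (expand L) F a b ↔ himp L a b ∈ F ∧ himp L b a ∈ F := by
  constructor
  · intro h
    have hc := isCongruence_leibniz (L := expand L) F
    have aux : ∀ c, leibniz (expand L) F a c → himp L a c ∈ F ∧ himp L c a ∈ F := by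
      intro c h
      refine ⟨compatible_leibniz F _ _ (hc.compat (n := 2) (Sum.inr NewConnective.imp)
        ![a, a] ![a, c] fun i => ?_) (hF.refl a), compatible_leibniz F _ _
        (hc.compat (n := 2) (Sum.inr NewConnective.imp) ![a, a] ![c, a] fun i => ?_) (hF.refl a)⟩
      · fin_cases i
        exacts [hc.equivalence.refl a, h]
      · fin_cases i
        exacts [h, hc.equivalence.refl a]
    exact aux b h
  · intro h
    refine le_leibniz (r := fun a b => himp L a b ∈ F ∧ himp L b a ∈ F)
      ⟨⟨fun a => ⟨hF.refl a, hF.refl a⟩, fun h => h.symm, fun h h' => ?_⟩, fun f x y hxy => ?_⟩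
      (fun c d hcd hc => hF.mp c d hc hcd.1) h
    · exact ⟨hF.trans h.1 h'.1 h'.2, hF.trans h'.2 h.2 h.1⟩
    · exact ⟨hF.rep f x y (fun i => (hxy i).1) fun i => (hxy i).2,
        hF.rep f y x (fun i => (hxy i).2) fun i => (hxy i).1⟩

end Model

theorem finitelyAlgebraizable_logicOf {L : FirstOrder.Language.{u, v}} (Φ : Set (Equation L ℕ))
    (α β : L.Term Unit) : (logicOf Φ α β).FinitelyAlgebraizable := by
  constructor
  · let δ (i j : Fin 2) : (expand L).Term (Fin 2) :=
      Term.func (l := 2) (Sum.inr NewConnective.imp) ![Term.var i, Term.var j]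
    have hδ : ∀ (A : Type u) [(expand L).Structure A] (i j : Fin 2) (h : Fin 2 → A),
        (δ i j).realize h = himp L (h i) (h j) := by
      intro A _ i j h
      refine congrArg (Structure.funMap _) (funext fun k => ?_)
      fin_cases k <;> rfl
    refine ⟨{δ 0 1, δ 1 0}, Set.toFinite _, fun A _ _ F hF a b => ?_⟩
    rw [(isModel_of_isFilter hF).leibniz_iff]
    simp [hδ]
  · refine ⟨{(Term.func (l := 1) (Sum.inr NewConnective.box) ![Term.var ()], Term.var ())},
      fun A _ _ F hF => ?_⟩
    have hM := isModel_of_isFilter hF.1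
    have hb : ∀ a : A, (Term.func (L := expand L) (l := 1) (Sum.inr NewConnective.box)
        ![Term.var ()]).realize (fun _ => a) = hbox L a := by
      intro a
      refine congrArg (Structure.funMap _) (funext fun k => ?_)
      fin_cases k
      rfl
    ext a
    rw [Set.mem_ofPred_eq]
    simp only [Set.mem_singleton_iff, forall_eq]
    refine Iff.trans ?_ (iff_of_eq (congrArg (· = a) (hb a).symm))
    rw [← hF.2, hM.leibniz_iff]
    exact ⟨fun h => ⟨hM.box_imp a h, hM.imp_box a h⟩, fun h => hM.of_box a h.1 h.2⟩

/-! ### Quotients of algebras -/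

section Quotient

variable {L : FirstOrder.Language.{u, v}} {A : Type u} [L.Structure A]

/-- The quotient of an algebra by an equivalence relation, the operations being computed on chosen
representatives. It is meaningful when `s` is a congruence. Relations are interpreted as empty. -/
@[reducible] noncomputable def quotientStructure (L : FirstOrder.Language.{u, v}) {A : Type u}
    [L.Structure A] (s : Setoid A) : L.Structure (Quotient s) where
  funMap f x := Quotient.mk s (Structure.funMap f fun i => (x i).out)
  RelMap _ _ := False

theorem realize_quotient {s : Setoid A} (hs : IsCongruence L s.r) {X : Type*} (t : L.Term X)
    (h : X → A) :
    letI := quotientStructure L s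
    t.realize (fun i => Quotient.mk s (h i)) = Quotient.mk s (t.realize h) := by
  let := quotientStructure L s
  induction t with
  | var i => rfl
  | func f ts ih =>
    simp only [Term.realize_func, ih]
    exact Quotient.sound (hs.compat f _ _ fun i => Quotient.mk_out (s := s) ((ts i).realize h))

end Quotient

theorem realize_termStructure {L : FirstOrder.Language.{u, v}} (t : Fm L) (σ : ℕ → Fm L) :
    t.realize σ = t.subst σ := by
  induction t with
  | var i => rfl
  | func f ts ih =>
    simp only [Term.realize_func, ih]
    rfl

theorem Logic.isFilter_theory {L : FirstOrder.Language.{u, v}} (𝓛 : Logic L) (T : Set (Fm L)) :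
    𝓛.IsFilter (𝓛.C T) := by
  intro Γ φ hφ σ hΓ
  rw [realize_termStructure]
  have h1 := 𝓛.structural σ Γ ⟨φ, hφ, rfl⟩
  refine (𝓛.C.closure_min ?_ (𝓛.C.isClosed_closure T)) h1
  rintro _ ⟨γ, hγ, rfl⟩
  simpa only [realize_termStructure] using hΓ γ hγ

/-! ### Fully Fregean logics are selfextensional -/

theorem selfextensional_of_fullyFregean {L : FirstOrder.Language.{u, v}} {Φ : Set (Equation L ℕ)}
    {α β : L.Term Unit} (h : (logicOf Φ α β).FullyFregean) :
    (logicOf Φ α β).Selfextensional := by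
  set 𝓛 := logicOf Φ α β
  let T : Set (Fm (expand L)) := 𝓛.C ∅
  have hc := isCongruence_leibniz (L := expand L) T
  let s : Setoid (Fm (expand L)) := ⟨leibniz (expand L) T, hc.equivalence⟩
  let := quotientStructure (expand L) s
  have hT : 𝓛.IsFilter T := 𝓛.isFilter_theory _
  have : Nonempty (Fm (expand L)) := ⟨var L 0⟩
  have : Nonempty (Quotient s) := ⟨Quotient.mk s (var L 0)⟩
  have hTM : IsModel Φ α β T := isModel_of_isFilter hT
  have hreal : ∀ (t : Fm (expand L)) (g : ℕ → Quotient s),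
      t.realize g = Quotient.mk s (t.realize fun i => (g i).out) := by
    intro t g
    rw [← realize_quotient hc]
    simp
  let F : Set (Quotient s) := {q | q.out ∈ T}
  have hF : ∀ φ, Quotient.mk s φ ∈ F ↔ φ ∈ T := by
    intro φ
    have := Quotient.mk_out (s := s) φ
    exact ⟨compatible_leibniz T _ _ this, compatible_leibniz T _ _ (hc.equivalence.symm this)⟩
  have hFf : 𝓛.IsFilter F := by
    intro Γ φ hφ g hg
    rw [hreal, hF]
    refine hT Γ φ hφ _ fun γ hγ => ?_
    rw [← hF, ← hreal]
    exact hg γ hγ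
  have hFM : IsModel Φ α β F := isModel_of_isFilter hFf
  have himp_mk : ∀ φ ψ : Fm (expand L),
      himp L (Quotient.mk s φ) (Quotient.mk s ψ) = Quotient.mk s (himp L φ ψ) := by
    intro φ ψ
    have := realize_quotient hc (imp (var L 0) (var L 1)) (fun i => if i = 0 then φ else ψ)
    simpa using this
  have hred : ∀ a b, leibniz (expand L) F a b → a = b := by
    intro a b
    refine Quotient.inductionOn₂ a b fun φ ψ hab => ?_
    rw [hFM.leibniz_iff, himp_mk, himp_mk, hF, hF] at hab
    exact Quotient.sound (hTM.leibniz_iff.2 hab)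
  have halg : 𝓛.InAlg (Quotient s) := by
    refine ⟨F, hFf, fun a b => ⟨fun hab => hred a b (hab F hFf subset_rfl), ?_⟩⟩
    rintro rfl G - -
    exact (isCongruence_leibniz G).equivalence.refl a
  have hsub : ∀ φ ψ, 𝓛.Entails {φ} ψ →
      𝓛.Fi (F ∪ {Quotient.mk s ψ}) ⊆ 𝓛.Fi (F ∪ {Quotient.mk s φ}) := by
    intro φ ψ hφψ
    refine Set.sInter_subset_sInter fun G hG => ⟨hG.1, Set.union_subset
      (Set.subset_union_left.trans hG.2) ?_⟩
    have hmk : ∀ t : Fm (expand L), t.realize (fun i => Quotient.mk s (Term.var i)) =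
        Quotient.mk s t := by
      intro t
      rw [realize_quotient hc]
      congr 1
      induction t with
      | var i => rfl
      | func f ts ih =>
        simp only [Term.realize_func, ih]
        rfl
    rw [Set.singleton_subset_iff, ← hmk]
    refine hG.1 _ _ hφψ _ fun γ hγ => ?_
    rw [Set.mem_singleton_iff.1 hγ, hmk]
    exact hG.2 (Or.inr rfl)
  have heq : 𝓛.InterDerivable = leibniz (expand L) T := by
    funext φ ψ
    refine propext ⟨fun hφψ => ?_, fun hφψ => ?_⟩
    · have := h _ halg F hFf (Quotient.mk s φ) (Quotient.mk s ψ)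
        ((hsub _ _ hφψ.2).antisymm (hsub _ _ hφψ.1))
      exact Quotient.exact (hred _ _ (this F hFf subset_rfl))
    · have aux : ∀ φ ψ, leibniz (expand L) T φ ψ → 𝓛.Entails {φ} ψ := by
        intro φ ψ hφψ
        have hM : IsModel Φ α β (𝓛.C {φ}) := isModel_of_isFilter (𝓛.isFilter_theory _)
        exact hM.mp φ ψ (𝓛.C.le_closure _ rfl)
          (𝓛.C.monotone (Set.empty_subset _) (hTM.leibniz_iff.1 hφψ).1)
      exact ⟨aux _ _ hφψ, aux _ _ (hc.equivalence.symm hφψ)⟩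
  rw [Logic.Selfextensional, heq]
  exact hc

/-! ### Selfextensionality forces the equation -/

section Counter

variable {L : FirstOrder.Language.{u, v}} {A : Type u}

open Classical in
/-- The algebra of the new connectives in which `a ⇒ b` is `o` for `a ≠ b`, while `p ⇒ p = p` and
`a ⇒ a = q` for `a ≠ p`, and in which the box moves `o` only. -/
@[reducible] noncomputable def counterStructure (o p q : A) : newLang.Structure A where
  funMap
    | NewConnective.box, x => if x 0 = o then p else x 0
    | NewConnective.imp, x => if x 0 = x 1 then (if x 0 = p then p else q) else o
  RelMap r _ := r.elim

open Classical in
theorem himp_counterStructure [L.Structure A] (o p q a b : A) :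
    letI := counterStructure o p q
    himp L a b = if a = b then (if a = p then p else q) else o := rfl

open Classical in
/-- The complement of `o` is a model of the calculus. Its only undesignated value is `o`, at which
`α` and `β` differ, so the premise of (W) fails whenever the conclusion does. -/
theorem isModel_counterFilter [L.Structure A] {Φ : Set (Equation L ℕ)} {α β : L.Term Unit}
    (hΦ : ∀ e ∈ Φ, Satisfies A e) {o p q : A} (hp : p ≠ o) (hq : q ≠ o)
    (ho : α.realize (fun _ => o) ≠ β.realize fun _ => o) :
    letI := counterStructure o p q
    IsModel (A := A) Φ α β {a | a ≠ o} := by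
  let := counterStructure o p q
  have hbox_def : ∀ a : A, hbox L a = if a = o then p else a := fun _ => rfl
  have himp_iff : ∀ a b : A, himp L a b ∈ {a | a ≠ o} ↔ a = b := by
    intro a b
    rw [himp_counterStructure]
    split_ifs <;> simp_all
  have hlift : ∀ {X : Type} (t : L.Term X) (g : X → A), (lift t).realize g = t.realize g :=
    fun t g => LHom.realize_onTerm _ t g
  refine ⟨?_, ?_, ?_, ?_, ?_, ?_, ?_, ?_, ?_⟩
  · exact fun a => (himp_iff a a).2 rfl
  · intro a b ha hab
    rwa [← (himp_iff a b).1 hab]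
  · intro n f x y hxy _
    rw [himp_iff, funext fun i => (himp_iff _ _).1 (hxy i)]
  · intro a ha
    rw [himp_iff, hbox_def, if_neg ha]
  · intro a ha
    rw [himp_iff, hbox_def, if_neg ha]
  · intro a ha _ hao
    rw [himp_iff, hbox_def, if_pos hao] at ha
    exact hp (ha.trans hao)
  · intro e he g
    rw [himp_iff, hlift, hlift]
    exact hΦ e he g
  · intro e he g
    rw [himp_iff, hlift, hlift]
    exact (hΦ e he g).symm
  · intro φ hφ g hg hgo
    rw [himp_iff, hlift, hlift, hgo] at hg
    exact ho hg

end Counter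

/-- The square of an algebra, as a power with index set `Bool`. -/
@[reducible] def squareStructure (L : FirstOrder.Language.{u, v}) (A : Type u) [L.Structure A] :
    L.Structure (Bool → A) where
  funMap f x := fun i => Structure.funMap f fun j => x j i
  RelMap _ _ := False

theorem realize_square {L : FirstOrder.Language.{u, v}} {A : Type u} [L.Structure A] {X : Type*}
    (t : L.Term X) (h : X → Bool → A) (i : Bool) :
    letI := squareStructure L A
    t.realize h i = t.realize fun x => h x i := by
  let := squareStructure L A
  induction t with
  | var x => rfl
  | func f ts ih =>
    simp only [Term.realize_func]
    exact congrArg (Structure.funMap f) (funext ih)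

theorem models_of_selfextensional {L : FirstOrder.Language.{u, v}} {V : AlgebraClass L}
    {Φ : Set (Equation L ℕ)} (hV : IsEquationalBasis Φ V) {α β : L.Term Unit}
    (h : (logicOf Φ α β).Selfextensional) : V.Models (α, β) := by
  intro A _ _ hA
  by_contra hne
  simp only [Satisfies, not_forall] at hne
  obtain ⟨g, hg⟩ := hne
  -- `A` has two distinct elements, the values of `α` and `β`. The counter-model needs two
  -- designated elements besides `o`, hence the square.
  let := squareStructure L A
  set a := g ()
  obtain ⟨c, hc⟩ : ∃ c : A, c ≠ a := by
    by_contra! hall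
    exact hg ((hall _).trans (hall _).symm)
  let o : Bool → A := fun _ => a
  let p : Bool → A := fun _ => c
  let q : Bool → A := fun i => if i then a else c
  have hp : p ≠ o := fun e => hc (congrFun e true)
  have hq : q ≠ o := fun e => hc (by simpa [o, q] using congrFun e false)
  have hqp : p ≠ q := fun e => hc (by simpa [p, q] using congrFun e true)
  have hΦ : ∀ e ∈ Φ, Satisfies (Bool → A) e := by
    intro e he x
    funext i
    rw [realize_square, realize_square]
    exact (hV A).1 hA e he _
  have ho : α.realize (fun _ => o) ≠ β.realize fun _ => o := by
    intro e
    have := congrFun e true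
    rw [realize_square, realize_square] at this
    exact hg this
  let := counterStructure o p q
  have hM := isModel_counterFilter hΦ hp hq ho
  have : Nonempty (Fm (expand L)) := ⟨var L 0⟩
  -- `x → x` and `y → y` are interderivable, so `(x → x) → (y → y)` would have to be a theorem.
  have hthm : ∀ (i : ℕ) (Γ), (logicOf Φ α β).Entails Γ (imp (var L i) (var L i)) := fun i Γ =>
    (isModel_of_isFilter ((logicOf Φ α β).isFilter_theory Γ)).refl (var L i)
  have hcong := h.compat (n := 2) (Sum.inr NewConnective.imp)
    ![imp (var L 0) (var L 0), imp (var L 0) (var L 0)]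
    ![imp (var L 0) (var L 0), imp (var L 1) (var L 1)]
    (fun i => by fin_cases i <;> exact ⟨hthm _ _, hthm _ _⟩)
  have hmem := hM.isFilter _ _ hcong.1 (fun i => if i = 0 then p else q) (by
    rintro _ rfl
    refine (congrArg (· ∈ {a | a ≠ o}) (realize_imp (A := Bool → A) _ _ _)).mpr ?_
    exact hM.refl _)
  have hval : himp L (himp L p p) (himp L q q) ∈ {a | a ≠ o} := by
    have := (congrArg (· ∈ {a | a ≠ o}) (realize_imp (A := Bool → A) (imp (var L 0) (var L 0))
      (imp (var L 1) (var L 1)) (fun i => if i = 0 then p else q))).mp hmem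
    simpa using this
  simp only [himp_counterStructure, if_true, if_neg hqp, if_neg hqp.symm] at hval
  exact hval rfl

/-! ### The deduction theorem -/

section Deduction

variable {L : FirstOrder.Language.{u, v}} {A : Type u} [(expand L).Structure A]
  {V : AlgebraClass L} {Φ : Set (Equation L ℕ)} {α β : L.Term Unit} {F : Set A}

/-- The quotient of an algebra by the Leibniz congruence of a deductive filter has its reduct in
`V`, so that equations valid in `V` hold up to the congruence formulas. -/
theorem IsModel.himp_mem_of_models [Nonempty A] (hF : IsModel Φ α β F) (hV : IsEquationalBasis Φ V)
    {X : Type} {e : Equation L X} (he : V.Models e) (g : X → A) :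
    himp L ((lift e.1).realize g) ((lift e.2).realize g) ∈ F := by
  have hc := isCongruence_leibniz (L := expand L) F
  let s : Setoid A := ⟨leibniz (expand L) F, hc.equivalence⟩
  let := quotientStructure (expand L) s
  let : L.Structure (Quotient s) :=
    (LHom.sumInl : L →ᴸ expand L).reduct (Quotient s)
  have : (LHom.sumInl : L →ᴸ expand L).IsExpansionOn (Quotient s) :=
    LHom.isExpansionOn_reduct _ _
  have : Nonempty (Quotient s) := ‹Nonempty A›.map (Quotient.mk s)
  have hreal : ∀ {Y : Type} (t : L.Term Y) (k : Y → A),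
      t.realize (fun i => Quotient.mk s (k i)) = Quotient.mk s ((lift t).realize k) := by
    intro Y t k
    rw [← realize_quotient hc]
    exact (LHom.realize_onTerm _ t _).symm
  have hQ : V (Quotient s) := by
    refine (hV _).2 fun e he k => ?_
    have hk : k = fun i => Quotient.mk s (k i).out := by
      funext i
      simp
    rw [hk, hreal, hreal]
    exact Quotient.sound (hF.leibniz_iff.2 ⟨hF.basis e he _, hF.basis_symm e he _⟩)
  have := he _ hQ fun i => Quotient.mk s (g i)
  rw [hreal, hreal] at this
  exact (hF.leibniz_iff.1 (Quotient.exact this)).1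

theorem IsModel.isPhi_mem [Nonempty A] (hF : IsModel Φ α β F) (hV : IsEquationalBasis Φ V)
    (h : V.Models (α, β)) {φ : Fm (expand L)} (hφ : IsPhi φ) (g : ℕ → A) : φ.realize g ∈ F :=
  hF.weak φ hφ g (hF.himp_mem_of_models hV h _)

/-- If `F` contains all instances of `φ₁, …, φ₆`, then the elements implied by `a` form a deductive
filter. -/
theorem isModel_residual (hF : IsModel Φ α β F)
    (hphi : ∀ φ : Fm (expand L), IsPhi φ → ∀ g : ℕ → A, φ.realize g ∈ F) (a : A) :
    IsModel Φ α β {c | himp L a c ∈ F} := by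
  have hsub : ∀ c ∈ F, himp L a c ∈ F := by
    intro c hc
    have := hphi _ .phi1 (fun i => if i = 0 then c else a)
    exact hF.mp _ _ hc (by simpa using this)
  have hmp : ∀ b c, himp L a b ∈ F → himp L a (himp L b c) ∈ F → himp L a c ∈ F := by
    intro b c hb hbc
    have := hphi _ .phi2 (fun i => if i = 0 then a else if i = 1 then b else c)
    exact hF.mp _ _ hb (hF.mp _ _ hbc (by simpa using this))
  refine ⟨fun b => hsub _ (hF.refl b), hmp, ?_, ?_, ?_, ?_, fun e he g => hsub _ (hF.basis e he g),
    fun e he g => hsub _ (hF.basis_symm e he g), fun φ hφ g _ => hsub _ (hphi φ hφ g)⟩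
  · intro n f x y hxy hyx
    let g : ℕ → A := interleave a x y
    -- Modus ponens under the hypothesis `a` strips the premises of `φ₃` one by one.
    have strip : ∀ (l : List (Fin n)) (χ : Fm (expand L)),
        himp L a ((l.foldr (fun i χ => imp (imp (xs L i) (ys L i))
          (imp (imp (ys L i) (xs L i)) χ)) χ).realize g) ∈ F →
        himp L a (χ.realize g) ∈ F := by
      intro l χ
      induction l with
      | nil => exact id
      | cons i l ih =>
        intro hl
        simp only [List.foldr_cons, realize_imp, xs, ys, realize_var, g, interleave_even,
          interleave_odd] at hl
        exact ih (hmp _ _ (hyx i) (hmp _ _ (hxy i) hl))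
    have := strip _ _ (hsub _ (hphi _ (.phi3 f) g))
    rw [realize_repConclusion] at this
    simp only [g, interleave_even, interleave_odd] at this
    exact this
  · intro b hb
    exact hmp _ _ hb (hsub _ (by simpa using hphi _ .phi5 fun _ => b))
  · intro b hb
    exact hmp _ _ hb (hsub _ (by simpa using hphi _ .phi4 fun _ => b))
  · intro b h1 h2
    exact hmp _ _ h2 (hmp _ _ h1 (hsub _ (by simpa using hphi _ .phi6 fun _ => b)))

end Deduction

theorem fullyFregean_of_models {L : FirstOrder.Language.{u, v}} {V : AlgebraClass L}
    {Φ : Set (Equation L ℕ)} (hV : IsEquationalBasis Φ V) {α β : L.Term Unit}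
    (h : V.Models (α, β)) : (logicOf Φ α β).FullyFregean := by
  intro A _ _ _ F hF a b hab G hG hFG
  have hM := isModel_of_isFilter hF
  have hded : ∀ a b : A, b ∈ (logicOf Φ α β).Fi (F ∪ {a}) → himp L a b ∈ F := by
    intro a b hb
    have hphi : ∀ φ : Fm (expand L), IsPhi φ → ∀ g : ℕ → A, φ.realize g ∈ F :=
      fun φ hφ g => hM.isPhi_mem hV h hφ g
    refine hb _ ⟨(isModel_residual hM hphi a).isFilter, Set.union_subset (fun c hc => ?_) ?_⟩
    · have := hphi _ .phi1 (fun i => if i = 0 then c else a)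
      exact hM.mp _ _ hc (by simpa using this)
    · exact Set.singleton_subset_iff.2 (hM.refl a)
  have hgen : ∀ a : A, a ∈ (logicOf Φ α β).Fi (F ∪ {a}) := fun a E hE => hE.2 (Or.inr rfl)
  exact (isModel_of_isFilter hG).leibniz_iff.2
    ⟨hFG (hded a b (hab ▸ hgen b)), hFG (hded b a (hab ▸ hgen a))⟩

end AAL

theorem theorem5p2 (L : FirstOrder.Language.{u, v}) [L.IsAlgebraic]
    (V : AAL.AlgebraClass L) (Φ : Set (AAL.Equation L ℕ)) (hΦ : Φ.Finite)
    (hV : AAL.IsEquationalBasis Φ V) (α β : L.Term Unit) :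
    (AAL.logicOf Φ α β).FinitelyAlgebraizable ∧
      List.TFAE [(AAL.logicOf Φ α β).FullyFregean,
        (AAL.logicOf Φ α β).Selfextensional,
        V.Models (α, β)] := by
  refine ⟨AAL.finitelyAlgebraizable_logicOf Φ α β, ?_⟩
  tfae_have 1 → 2 := AAL.selfextensional_of_fullyFregean
  tfae_have 2 → 3 := AAL.models_of_selfextensional hV
  tfae_have 3 → 1 := AAL.fullyFregean_of_models hV
  tfae_finish
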